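/- Let $D\in GL(2,\mathbb Z)$ be a hyperbolic automorphism of the torus $\mathbb R^2/\mathbb Z^2$ (no eigenvalue of modulus one). Choose linear coordinates $(x,y)$ on the plane whose horizontal axis is the stable direction and whose vertical axis is the unstable direction of $D$, so that in them $D=\mathrm{diag}(\mu,\lambda)$ with $|\mu|<1<|\lambda|$. Let $\mathcal F$ be the family of bases $\{e,f\}$ of the lattice $\mathbb Z^2$ such that, in these coordinates, $e$ lies in the open first quadrant and $f$ in the open second quadrant. Fix $\{e_0,f_0\}\in\mathcal F$ and define $\{e_n,f_n\}\in\mathcal F$, $n\in\mathbb Z$, as follows. Forward: $\{e_{n+1},f_{n+1}\}=\{e_n+f_n,f_n\}$ if $e_n+f_n$ lies in the right half-plane, and $\{e_n,e_n+f_n\}$ if it lies in the left half-plane. Backward: $\{e_{n-1},f_{n-1}\}=\{e_n-f_n,f_n\}$ if $e_n-f_n$ lies in the upper half-plane, and $\{e_n,f_n-e_n\}$ if $f_n-e_n$ does. The cutting sequence is $s_n=0$ if $e_{n+1}=e_n$ and $s_n=1$ if $f_{n+1}=f_n$ ($n\in\mathbb Z$). An integer $N\ge 1$ is a period of it if $s_{k+N}=s_k$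 for all $k\in\mathbb Z$, and a semi-period if $s_{k+N}=1-s_k$ for all $k\in\mathbb Z$; the smallest one is called basic. Then the cutting sequence is periodic. Let $N$ be its basic semi-period if it has a semi-period, and its basic period otherwise. There is a unique $G\in GL(2,\mathbb Z)$ with $G e_0=f_N$, $G f_0=e_N$ in the case of the semi-period, respectively with $G e_0=e_N$, $G f_0=f_N$ in the case of the period. It maps the vertical axis onto itself and the horizontal axis onto itself, and there is an integer $K\ge 1$ such that $G^K=D$ or $G^K=-D$. Moreover, the centralizer of $D$ in $GL(2,\mathbb Z)$ is equal to $\{\pm G^k : k\in\mathbb Z\}$. -/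

import Mathlib

namespace ToralBiFan

/-- The linear map of `ℝ²` given by an element of `GL(2,ℤ)`; it descends to the corresponding
automorphism of the torus `ℝ²/ℤ²`. -/
noncomputable def realMap (A : Matrix.GeneralLinearGroup (Fin 2) ℤ) :
    (Fin 2 → ℝ) →ₗ[ℝ] (Fin 2 → ℝ) :=
  Matrix.toLin' ((A : Matrix (Fin 2) (Fin 2) ℤ).map (fun m : ℤ => (m : ℝ)))

/-- A toral automorphism is hyperbolic if it has no (complex) eigenvalue of modulus one. -/
def IsHyperbolic (A : Matrix.GeneralLinearGroup (Fin 2) ℤ) : Prop :=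
  ∀ z ∈ spectrum ℂ ((A : Matrix (Fin 2) (Fin 2) ℤ).map (fun m : ℤ => (m : ℂ))), ‖z‖ ≠ 1

/-- Linear coordinates `(x, y)` on the plane whose horizontal axis is the stable direction of `D`
and whose vertical axis is the unstable direction: in these coordinates `D` is the diagonal matrix
`diag(μ, lam)` with `|μ| < 1 < |lam|`. -/
def IsAdapted (D : Matrix.GeneralLinearGroup (Fin 2) ℤ) (φ : (Fin 2 → ℝ) ≃ₗ[ℝ] ℝ × ℝ) : Prop :=
  ∃ μ lam : ℝ, |μ| < 1 ∧ 1 < |lam| ∧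
    ∀ v : Fin 2 → ℝ, φ (realMap D v) = (μ * (φ v).1, lam * (φ v).2)

/-- The line `y = 0`. -/
noncomputable def horizontalAxis (φ : (Fin 2 → ℝ) ≃ₗ[ℝ] ℝ × ℝ) : Submodule ℝ (Fin 2 → ℝ) :=
  LinearMap.ker (LinearMap.snd ℝ ℝ ℝ ∘ₗ φ.toLinearMap)

/-- The line `x = 0`. -/
noncomputable def verticalAxis (φ : (Fin 2 → ℝ) ≃ₗ[ℝ] ℝ × ℝ) : Submodule ℝ (Fin 2 → ℝ) :=
  LinearMap.ker (LinearMap.fst ℝ ℝ ℝ ∘ₗ φ.toLinearMap)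

/-- Both axes are mapped onto themselves. -/
def PreservesAxes (φ : (Fin 2 → ℝ) ≃ₗ[ℝ] ℝ × ℝ) (A : Matrix.GeneralLinearGroup (Fin 2) ℤ) : Prop :=
  (verticalAxis φ).map (realMap A) = verticalAxis φ ∧
    (horizontalAxis φ).map (realMap A) = horizontalAxis φ

/-- Horizontal coordinate of a lattice vector. -/
noncomputable def xCoord (φ : (Fin 2 → ℝ) ≃ₗ[ℝ] ℝ × ℝ) (v : Fin 2 → ℤ) : ℝ :=
  (φ (fun i => (v i : ℝ))).1

/-- Vertical coordinate of a lattice vector. -/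
noncomputable def yCoord (φ : (Fin 2 → ℝ) ≃ₗ[ℝ] ℝ × ℝ) (v : Fin 2 → ℤ) : ℝ :=
  (φ (fun i => (v i : ℝ))).2

/-- Membership in the bi-fan: `(e, f)` is a basis of the lattice, with `e` in the open first
quadrant and `f` in the open second quadrant. -/
def MemBiFan (φ : (Fin 2 → ℝ) ≃ₗ[ℝ] ℝ × ℝ) (e f : Fin 2 → ℤ) : Prop :=
  LinearIndependent ℤ ![e, f] ∧ Submodule.span ℤ {e, f} = ⊤ ∧
    (0 < xCoord φ e ∧ 0 < yCoord φ e) ∧ (xCoord φ f < 0 ∧ 0 < yCoord φ f)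

/-- One step of the cutting algorithm: `e + f` replaces `e` if it lies in the right half-plane,
and `f` otherwise. -/
noncomputable def cutForward (φ : (Fin 2 → ℝ) ≃ₗ[ℝ] ℝ × ℝ)
    (p : (Fin 2 → ℤ) × (Fin 2 → ℤ)) : (Fin 2 → ℤ) × (Fin 2 → ℤ) :=
  if 0 < xCoord φ (p.1 + p.2) then (p.1 + p.2, p.2) else (p.1, p.1 + p.2)

/-- One backward step. If `e - f` is in the upper half-plane (it is then in the first quadrant) it
replaces `e`; otherwise `f - e` is in the upper half-plane (and in the second quadrant) and it
replaces `f`. -/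
noncomputable def cutBackward (φ : (Fin 2 → ℝ) ≃ₗ[ℝ] ℝ × ℝ)
    (p : (Fin 2 → ℤ) × (Fin 2 → ℤ)) : (Fin 2 → ℤ) × (Fin 2 → ℤ) :=
  if 0 < yCoord φ (p.1 - p.2) then (p.1 - p.2, p.2) else (p.1, p.2 - p.1)

/-- The two-sided sequence of bases `(e_n, f_n)` produced from `(e_0, f_0)`. -/
noncomputable def bases (φ : (Fin 2 → ℝ) ≃ₗ[ℝ] ℝ × ℝ) (e₀ f₀ : Fin 2 → ℤ) :
    ℤ → (Fin 2 → ℤ) × (Fin 2 → ℤ)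
  | Int.ofNat n => (cutForward φ)^[n] (e₀, f₀)
  | Int.negSucc n => (cutBackward φ)^[n + 1] (e₀, f₀)

/-- The cutting sequence: `s_n = 0` if `e_{n+1} = e_n`, and `s_n = 1` if not, that is, if
`f_{n+1} = f_n` (exactly one of the two vectors changes at each step). -/
noncomputable def cuttingSeq (φ : (Fin 2 → ℝ) ≃ₗ[ℝ] ℝ × ℝ) (e₀ f₀ : Fin 2 → ℤ) (n : ℤ) : ℤ :=
  if (bases φ e₀ f₀ (n + 1)).1 = (bases φ e₀ f₀ n).1 then 0 else 1

def IsPeriod (s : ℤ → ℤ) (N : ℕ) : Prop := 0 < N ∧ ∀ k : ℤ, s (k + N) = s k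

def IsSemiPeriod (s : ℤ → ℤ) (N : ℕ) : Prop := 0 < N ∧ ∀ k : ℤ, s (k + N) = 1 - s k

def IsBasicPeriod (s : ℤ → ℤ) (N : ℕ) : Prop := IsLeast {n | IsPeriod s n} N

def IsBasicSemiPeriod (s : ℤ → ℤ) (N : ℕ) : Prop := IsLeast {n | IsSemiPeriod s n} N

/-- `G` preserves both axes, `G ^ K = ± D` for some natural number `K ≥ 1`, and the centralizer of
`D` in `GL(2,ℤ)` is `{± G ^ k | k ∈ ℤ}`. -/
def IsGeneratorOf (φ : (Fin 2 → ℝ) ≃ₗ[ℝ] ℝ × ℝ) (D G : Matrix.GeneralLinearGroup (Fin 2) ℤ) :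
    Prop :=
  PreservesAxes φ G ∧
    (∃ K : ℕ, 0 < K ∧ (G ^ K = D ∨ G ^ K = -D)) ∧
    (Subgroup.centralizer {D} : Set (Matrix.GeneralLinearGroup (Fin 2) ℤ)) =
      {A | ∃ k : ℤ, A = G ^ k ∨ A = -G ^ k}

end ToralBiFan

/-!
The cutting step is a permutation of the bi-fan, and this permutation is transitive: if `q` is
another basis in the bi-fan, written as `q.1 = a p.1 + b p.2`, `q.2 = c p.1 + d p.2`, then `a`, `d`
are positive and `ad - bc = 1`, so `bc ≥ 0` and one of the two cones contains the other. Cutting the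
larger cone is then a Euclidean algorithm which ends with the smaller one.

An automorphism which is diagonal in the coordinates and preserves the upper half-plane permutes the
unordered bases of the bi-fan and commutes with cutting. By transitivity it translates the sequence
of these bases by some integer, which determines it. It preserves the cutting sequence or exchanges
`0` and `1` in it, according to whether it preserves the right half-plane or exchanges it with the
left one. Conversely, the cutting sequence together with one basis determines all the bases, so
every period and every semi-period comes from such a translation. Up to sign `D` is one of them, by
a positive integer since it stretches the vertical axis, and these translations are also
diagonal because they commute with `D`. The centralizer of `D` therefore consists of the
translations and their negatives, and `G`, the translation by the least positive integer,
generates the group of all translations.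
-/

namespace ToralBiFan

open Matrix

variable {φ : (Fin 2 → ℝ) ≃ₗ[ℝ] ℝ × ℝ} {A B D G : GeneralLinearGroup (Fin 2) ℤ} {α β γ δ : ℝ}
  {e₀ f₀ v : Fin 2 → ℤ} {p q r : (Fin 2 → ℤ) × (Fin 2 → ℤ)}

/-! ### Coordinates of lattice vectors -/

/-- The coordinates `(x, y)` as a `ℤ`-linear map on the lattice, so that the linearity of `xCoord`
and `yCoord` can be read off. -/
noncomputable def coords (φ : (Fin 2 → ℝ) ≃ₗ[ℝ] ℝ × ℝ) : (Fin 2 → ℤ) →ₗ[ℤ] ℝ × ℝ :=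
  φ.toLinearMap.restrictScalars ℤ ∘ₗ (Int.castAddHom ℝ).toIntLinearMap.compLeft (Fin 2)

theorem xCoord_zero : xCoord φ 0 = 0 := congrArg Prod.fst (coords φ).map_zero

theorem yCoord_zero : yCoord φ 0 = 0 := congrArg Prod.snd (coords φ).map_zero

theorem xCoord_add (v w : Fin 2 → ℤ) : xCoord φ (v + w) = xCoord φ v + xCoord φ w :=
  congrArg Prod.fst ((coords φ).map_add v w)

theorem yCoord_add (v w : Fin 2 → ℤ) : yCoord φ (v + w) = yCoord φ v + yCoord φ w :=
  congrArg Prod.snd ((coords φ).map_add v w)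

theorem xCoord_sub (v w : Fin 2 → ℤ) : xCoord φ (v - w) = xCoord φ v - xCoord φ w :=
  congrArg Prod.fst ((coords φ).map_sub v w)

theorem yCoord_sub (v w : Fin 2 → ℤ) : yCoord φ (v - w) = yCoord φ v - yCoord φ w :=
  congrArg Prod.snd ((coords φ).map_sub v w)

theorem xCoord_smul (c : ℤ) (v : Fin 2 → ℤ) : xCoord φ (c • v) = c * xCoord φ v :=
  (congrArg Prod.fst ((coords φ).map_smul c v)).trans (zsmul_eq_mul _ _)

theorem yCoord_smul (c : ℤ) (v : Fin 2 → ℤ) : yCoord φ (c • v) = c * yCoord φ v :=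
  (congrArg Prod.snd ((coords φ).map_smul c v)).trans (zsmul_eq_mul _ _)

/-! ### Automorphisms that are diagonal in the coordinates -/

theorem realMap_mul (A B : GeneralLinearGroup (Fin 2) ℤ) :
    realMap (A * B) = realMap A ∘ₗ realMap B := by
  rw [realMap, realMap, realMap, ← toLin'_mul]
  exact congrArg toLin' (map_mul (Int.castRingHom ℝ).mapMatrix A.1 B.1)

theorem realMap_one : realMap 1 = LinearMap.id :=
  (congrArg toLin' (map_one (Int.castRingHom ℝ).mapMatrix)).trans toLin'_one

theorem realMap_neg (A : GeneralLinearGroup (Fin 2) ℤ) : realMap (-A) = -realMap A :=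
  (congrArg toLin' (map_neg (Int.castRingHom ℝ).mapMatrix A.1)).trans (map_neg _ _)

theorem realMap_injective : Function.Injective realMap := fun _ _ h =>
  Units.ext (Matrix.map_injective Int.cast_injective (toLin'.injective h))

theorem realMap_intCast (A : GeneralLinearGroup (Fin 2) ℤ) (v : Fin 2 → ℤ) :
    realMap A (fun i => (v i : ℝ)) = fun i => ((A.1 *ᵥ v) i : ℝ) :=
  funext fun i => ((Int.castRingHom ℝ).map_mulVec A.1 v i).symm

theorem realMap_realMap_inv (A : GeneralLinearGroup (Fin 2) ℤ) (v : Fin 2 → ℝ) :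
    realMap A (realMap A⁻¹ v) = v := by
  rw [← LinearMap.comp_apply, ← realMap_mul, mul_inv_cancel, realMap_one, LinearMap.id_apply]

/-- `A` is `diag(α, β)` in the coordinates `φ`. -/
def IsDiag (φ : (Fin 2 → ℝ) ≃ₗ[ℝ] ℝ × ℝ) (A : GeneralLinearGroup (Fin 2) ℤ) (α β : ℝ) : Prop :=
  ∀ v : Fin 2 → ℝ, φ (realMap A v) = (α * (φ v).1, β * (φ v).2)

namespace IsDiag

theorem xCoord_mulVec (hA : IsDiag φ A α β) (v : Fin 2 → ℤ) :
    xCoord φ (A.1 *ᵥ v) = α * xCoord φ v := by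
  simp only [xCoord, ← realMap_intCast, hA _]

theorem yCoord_mulVec (hA : IsDiag φ A α β) (v : Fin 2 → ℤ) :
    yCoord φ (A.1 *ᵥ v) = β * yCoord φ v := by
  simp only [yCoord, ← realMap_intCast, hA _]

/-- Exchanging the two coordinates turns a statement on one axis into a statement on the other. -/
theorem prodComm (hA : IsDiag φ A α β) : IsDiag (φ ≪≫ₗ LinearEquiv.prodComm ℝ ℝ ℝ) A β α :=
  fun v => congrArg Prod.swap (hA v)

theorem unique (hA : IsDiag φ A α β) (hB : IsDiag φ B α β) : A = B :=
  realMap_injective (LinearMap.ext fun v => φ.injective ((hA v).trans (hB v).symm))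

theorem one : IsDiag φ 1 1 1 := fun v => by simp [realMap_one]

theorem mul (hA : IsDiag φ A α β) (hB : IsDiag φ B γ δ) : IsDiag φ (A * B) (α * γ) (β * δ) :=
  fun v => by rw [realMap_mul, LinearMap.comp_apply, hA, hB, mul_assoc, mul_assoc]

theorem neg (hA : IsDiag φ A α β) : IsDiag φ (-A) (-α) (-β) := fun v => by
  rw [realMap_neg, LinearMap.neg_apply, map_neg, hA, Prod.neg_mk, neg_mul, neg_mul]

theorem pow (hA : IsDiag φ A α β) (n : ℕ) : IsDiag φ (A ^ n) (α ^ n) (β ^ n) := by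
  induction n with
  | zero => simpa only [pow_zero] using one
  | succ n ih => simpa only [pow_succ] using ih.mul hA

theorem commute (hA : IsDiag φ A α β) (hB : IsDiag φ B γ δ) : Commute A B :=
  (hA.mul hB).unique (by simpa only [mul_comm] using hB.mul hA)

theorem ne_zero (hA : IsDiag φ A α β) : α ≠ 0 ∧ β ≠ 0 := by
  have h := hA (realMap A⁻¹ (φ.symm (1, 1)))
  rw [realMap_realMap_inv, LinearEquiv.apply_symm_apply, Prod.mk.injEq] at h
  exact ⟨left_ne_zero_of_mul_eq_one h.1.symm, left_ne_zero_of_mul_eq_one h.2.symm⟩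

theorem inv (hA : IsDiag φ A α β) : IsDiag φ A⁻¹ α⁻¹ β⁻¹ := fun v => by
  have h := hA (realMap A⁻¹ v)
  rw [realMap_realMap_inv] at h
  rw [h, inv_mul_cancel_left₀ hA.ne_zero.1, inv_mul_cancel_left₀ hA.ne_zero.2]

theorem map_verticalAxis_le (hA : IsDiag φ A α β) :
    (verticalAxis φ).map (realMap A) ≤ verticalAxis φ := by
  rintro _ ⟨v, hv, rfl⟩
  have hv : (φ v).1 = 0 := hv
  change (φ (realMap A v)).1 = 0
  rw [hA, hv, mul_zero]

theorem map_verticalAxis (hA : IsDiag φ A α β) :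
    (verticalAxis φ).map (realMap A) = verticalAxis φ :=
  hA.map_verticalAxis_le.antisymm fun v hv =>
    ⟨realMap A⁻¹ v, hA.inv.map_verticalAxis_le ⟨v, hv, rfl⟩, realMap_realMap_inv A v⟩

theorem preservesAxes (hA : IsDiag φ A α β) : PreservesAxes φ A :=
  ⟨hA.map_verticalAxis, hA.prodComm.map_verticalAxis⟩

theorem exists_of_commute (hA : IsDiag φ A α β) (hne : α ≠ β) (hAB : Commute A B) :
    ∃ γ δ, IsDiag φ B γ δ := by
  have hcomm (v : Fin 2 → ℝ) :
      φ (realMap B (realMap A v)) = (α * (φ (realMap B v)).1, β * (φ (realMap B v)).2) := by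
    rw [← LinearMap.comp_apply, ← realMap_mul, ← hAB.eq, realMap_mul, LinearMap.comp_apply, hA]
  obtain ⟨u, hu⟩ := φ.surjective (1, 0)
  obtain ⟨w, hw⟩ := φ.surjective (0, 1)
  have hAu : realMap A u = α • u := φ.injective (by rw [hA]; simp [hu])
  have hAw : realMap A w = β • w := φ.injective (by rw [hA]; simp [hw])
  have hBu : (φ (realMap B u)).2 = 0 := by
    have h := congrArg Prod.snd (hcomm u)
    simp only [hAu, map_smul, Prod.smul_snd, smul_eq_mul] at h
    exact (mul_eq_mul_right_iff.1 h).resolve_left hne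
  have hBw : (φ (realMap B w)).1 = 0 := by
    have h := congrArg Prod.fst (hcomm w)
    simp only [hAw, map_smul, Prod.smul_fst, smul_eq_mul] at h
    exact (mul_eq_mul_right_iff.1 h).resolve_left hne.symm
  refine ⟨(φ (realMap B u)).1, (φ (realMap B w)).2, fun v => ?_⟩
  have hv : v = (φ v).1 • u + (φ v).2 • w := φ.injective (by simp [hu, hw])
  have hBv : realMap B v = (φ v).1 • realMap B u + (φ v).2 • realMap B w := by
    conv_lhs => rw [hv, map_add, map_smul, map_smul]
  rw [hBv]
  ext <;> simp [hBu, hBw, mul_comm]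

/-- A lattice vector on a contracted axis has iterates of length less than one, hence one that is
zero. -/
theorem eq_zero_of_yCoord_eq_zero (hA : IsDiag φ A α β) (hα : |α| < 1) (hv : yCoord φ v = 0) :
    v = 0 := by
  ext i
  have hpow (n : ℕ) : (((A ^ n).1 *ᵥ v) i : ℝ) = α ^ n * v i := by
    have h : realMap (A ^ n) (fun i => (v i : ℝ)) = α ^ n • fun i => (v i : ℝ) := by
      refine φ.injective ?_
      have hv : (φ fun i => (v i : ℝ)).2 = 0 := hv
      rw [hA.pow n, map_smul]
      ext <;> simp [hv]
    simpa [realMap_intCast] using congrFun h i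
  obtain ⟨n, hn⟩ := exists_pow_lt_of_lt_one (by positivity : 0 < (|(v i : ℝ)| + 1)⁻¹) hα
  have hlt : |α ^ n * v i| < 1 :=
    calc |α ^ n * v i| = |α| ^ n * |(v i : ℝ)| := by rw [abs_mul, abs_pow]
      _ ≤ |α| ^ n * (|(v i : ℝ)| + 1) := by gcongr; exact (lt_add_one _).le
      _ < 1 := by rwa [← lt_inv_mul_iff₀' (by positivity), mul_one]
  have hzero : ((A ^ n).1 *ᵥ v) i = 0 := by
    rw [← Int.abs_lt_one_iff]
    exact_mod_cast (hpow n).symm ▸ hlt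
  have h := hpow n
  rw [hzero, Int.cast_zero, eq_comm, mul_eq_zero] at h
  exact_mod_cast h.resolve_left (pow_ne_zero n hA.ne_zero.1)

end IsDiag

/-- The axes contain no nonzero lattice vector. -/
def AxesIrrational (φ : (Fin 2 → ℝ) ≃ₗ[ℝ] ℝ × ℝ) : Prop :=
  ∀ v, v ≠ 0 → xCoord φ v ≠ 0 ∧ yCoord φ v ≠ 0

theorem AxesIrrational.xCoord_ne_zero (hφ : AxesIrrational φ) (hv : yCoord φ v ≠ 0) :
    xCoord φ v ≠ 0 :=
  (hφ v fun h => hv (h ▸ yCoord_zero)).1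

theorem AxesIrrational.yCoord_ne_zero (hφ : AxesIrrational φ) (hv : xCoord φ v ≠ 0) :
    yCoord φ v ≠ 0 :=
  (hφ v fun h => hv (h ▸ xCoord_zero)).2

theorem IsAdapted.axesIrrational (hD : IsAdapted D φ) : AxesIrrational φ := by
  obtain ⟨μ, lam, hμ, hlam, hD⟩ := hD
  have hD : IsDiag φ D μ lam := hD
  have hlam' : |lam⁻¹| < 1 := by rw [abs_inv]; exact inv_lt_one_of_one_lt₀ hlam
  exact fun v hv => ⟨fun h => hv (hD.inv.prodComm.eq_zero_of_yCoord_eq_zero hlam' h),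
    fun h => hv (hD.eq_zero_of_yCoord_eq_zero hμ h)⟩

theorem IsAdapted.mem_centralizer_iff (hD : IsAdapted D φ) :
    A ∈ Subgroup.centralizer {D} ↔ ∃ γ δ, IsDiag φ A γ δ := by
  obtain ⟨μ, lam, hμ, hlam, hD⟩ := hD
  have hne : μ ≠ lam := by rintro rfl; exact (hμ.trans hlam).false
  rw [Subgroup.mem_centralizer_singleton_iff]
  exact ⟨fun h => IsDiag.exists_of_commute hD hne h.symm,
    fun ⟨_, _, hA⟩ => hA.commute (α := _) hD⟩

theorem IsAdapted.exists_expanding (hD : IsAdapted D φ) :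
    ∃ D' μ lam, (D' = D ∨ D' = -D) ∧ 1 < lam ∧ IsDiag φ D' μ lam := by
  obtain ⟨μ, lam, -, hlam, hD⟩ := hD
  rcases lt_abs.1 hlam with h | h
  · exact ⟨D, μ, lam, .inl rfl, h, hD⟩
  · exact ⟨-D, -μ, -lam, .inr rfl, h, IsDiag.neg hD⟩

/-! ### Cutting a basis in the bi-fan -/

/-- The action of `GL(2, ℤ)` on pairs of lattice vectors. -/
def mapPair (A : GeneralLinearGroup (Fin 2) ℤ) (p : (Fin 2 → ℤ) × (Fin 2 → ℤ)) :
    (Fin 2 → ℤ) × (Fin 2 → ℤ) :=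
  (A.1 *ᵥ p.1, A.1 *ᵥ p.2)

theorem mulVec_fst_add_snd (A : GeneralLinearGroup (Fin 2) ℤ) (p : (Fin 2 → ℤ) × (Fin 2 → ℤ)) :
    A.1 *ᵥ (p.1 + p.2) = (mapPair A p).1 + (mapPair A p).2 :=
  mulVec_add _ _ _

/-- The matrix with columns `p.1` and `p.2`. -/
def colMatrix (p : (Fin 2 → ℤ) × (Fin 2 → ℤ)) : Matrix (Fin 2) (Fin 2) ℤ := (of ![p.1, p.2])ᵀ

theorem det_colMatrix (p : (Fin 2 → ℤ) × (Fin 2 → ℤ)) :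
    (colMatrix p).det = p.1 0 * p.2 1 - p.2 0 * p.1 1 := by
  simp [colMatrix, det_fin_two, mul_comm]

theorem det_colMatrix_swap (p : (Fin 2 → ℤ) × (Fin 2 → ℤ)) :
    (colMatrix p.swap).det = -(colMatrix p).det := by
  rw [det_colMatrix, det_colMatrix, neg_sub, Prod.fst_swap, Prod.snd_swap]

theorem colMatrix_injective : Function.Injective colMatrix := fun p q h => by
  have h := of.injective (transpose_injective h)
  exact Prod.ext (congrFun h 0) (congrFun h 1)

theorem mul_colMatrix (A : GeneralLinearGroup (Fin 2) ℤ) (p : (Fin 2 → ℤ) × (Fin 2 → ℤ)) :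
    A.1 * colMatrix p = colMatrix (mapPair A p) := by
  ext i j
  fin_cases j <;> rfl

theorem exists_mapPair_eq_iff (hp : IsUnit (colMatrix p).det) (hq : IsUnit (colMatrix q).det) :
    ∃ G, ∀ A, mapPair A p = q ↔ A = G := by
  obtain ⟨P, hP⟩ := (isUnit_iff_isUnit_det _).2 hp
  obtain ⟨Q, hQ⟩ := (isUnit_iff_isUnit_det _).2 hq
  refine ⟨Q * P⁻¹, fun A => ?_⟩
  rw [eq_mul_inv_iff_mul_eq, Units.ext_iff, Units.val_mul, hP, hQ, mul_colMatrix,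
    colMatrix_injective.eq_iff]

/-- The bi-fan of the coordinates `φ`: the ordered lattice bases `(e, f)` with `e` in the first and
`f` in the second quadrant. -/
def biFan (φ : (Fin 2 → ℝ) ≃ₗ[ℝ] ℝ × ℝ) : Set ((Fin 2 → ℤ) × (Fin 2 → ℤ)) :=
  {p | MemBiFan φ p.1 p.2}

theorem mem_biFan_iff : p ∈ biFan φ ↔ IsUnit (colMatrix p).det ∧
    (0 < xCoord φ p.1 ∧ 0 < yCoord φ p.1) ∧ (xCoord φ p.2 < 0 ∧ 0 < yCoord φ p.2) := by
  have hdet : (colMatrix p).det = (Pi.basisFun ℤ (Fin 2)).det ![p.1, p.2] := by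
    rw [Pi.basisFun_det_apply, colMatrix, det_transpose]
  rw [hdet, ← Module.Basis.is_basis_iff_det, range_cons_cons_empty, and_assoc]
  rfl

/-- Replaces `p.2` by the sum `p.1 + p.2` if `c = 0`, and `p.1` if `c = 1`. -/
def cutWith (c : ℤ) (p : (Fin 2 → ℤ) × (Fin 2 → ℤ)) : (Fin 2 → ℤ) × (Fin 2 → ℤ) :=
  if c = 0 then (p.1, p.1 + p.2) else (p.1 + p.2, p.2)

/-- `q` arises from `p` by a cutting step, without regard to the position of the vectors. -/
def IsCut (p q : (Fin 2 → ℤ) × (Fin 2 → ℤ)) : Prop := ∃ c, q = cutWith c p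

theorem isCut_iff : IsCut p q ↔ q = (p.1, p.1 + p.2) ∨ q = (p.1 + p.2, p.2) := by
  refine ⟨fun ⟨c, hc⟩ => ?_, fun h => h.elim (⟨0, ·⟩) (⟨1, ·⟩)⟩
  rw [cutWith] at hc
  split_ifs at hc
  exacts [.inl hc, .inr hc]

theorem mapPair_cutWith (A : GeneralLinearGroup (Fin 2) ℤ) (c : ℤ)
    (p : (Fin 2 → ℤ) × (Fin 2 → ℤ)) : mapPair A (cutWith c p) = cutWith c (mapPair A p) := by
  unfold cutWith
  split_ifs <;> simp only [mapPair, mulVec_add]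

theorem swap_cutWith {c : ℤ} (hc : c = 0 ∨ c = 1) (p : (Fin 2 → ℤ) × (Fin 2 → ℤ)) :
    (cutWith c p).swap = cutWith (1 - c) p.swap := by
  rcases hc with rfl | rfl <;> simp [cutWith, add_comm]

theorem IsCut.mapPair (h : IsCut p q) (A : GeneralLinearGroup (Fin 2) ℤ) :
    IsCut (mapPair A p) (mapPair A q) := by
  obtain ⟨c, rfl⟩ := h
  exact ⟨c, mapPair_cutWith A c p⟩

theorem IsCut.swap (h : IsCut p q) : IsCut p.swap q.swap := by
  rw [isCut_iff] at h ⊢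
  rcases h with rfl | rfl <;> simp [add_comm]

theorem IsCut.det_eq (h : IsCut p q) : (colMatrix q).det = (colMatrix p).det := by
  rw [isCut_iff] at h
  rcases h with rfl | rfl <;> simp only [det_colMatrix, Pi.add_apply] <;> ring

theorem IsCut.right_unique (hpq : IsCut p q) (hpr : IsCut p r) (hq : q ∈ biFan φ)
    (hr : r ∈ biFan φ) : q = r := by
  obtain ⟨-, ⟨hq₁, -⟩, hq₂, -⟩ := mem_biFan_iff.1 hq
  obtain ⟨-, ⟨hr₁, -⟩, hr₂, -⟩ := mem_biFan_iff.1 hr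
  rw [isCut_iff] at hpq hpr
  rcases hpq with rfl | rfl <;> rcases hpr with rfl | rfl
  exacts [rfl, (hq₂.asymm hr₁).elim, (hr₂.asymm hq₁).elim, rfl]

theorem IsCut.left_unique (hqp : IsCut q p) (hrp : IsCut r p) (hq : q ∈ biFan φ)
    (hr : r ∈ biFan φ) : q = r := by
  obtain ⟨-, ⟨-, hq₁⟩, -, hq₂⟩ := mem_biFan_iff.1 hq
  obtain ⟨-, ⟨-, hr₁⟩, -, hr₂⟩ := mem_biFan_iff.1 hr
  have habsurd {u v : (Fin 2 → ℤ) × (Fin 2 → ℤ)} (hu : 0 < yCoord φ u.2) (hv : 0 < yCoord φ v.1)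
      (h₁ : u.1 = v.1 + v.2) (h₂ : u.1 + u.2 = v.2) : False := by
    have h₁ := congrArg (yCoord φ) h₁
    have h₂ := congrArg (yCoord φ) h₂
    rw [yCoord_add] at h₁ h₂
    linarith
  rw [isCut_iff] at hqp hrp
  rcases hqp with rfl | rfl <;> rcases hrp with h | h <;>
    obtain ⟨h₁, h₂⟩ := Prod.mk.inj h
  · exact Prod.ext h₁ (add_left_cancel (h₂.trans (congrArg (· + r.2) h₁.symm)))
  · exact (habsurd hq₂ hr₁ h₁ h₂).elim
  · exact (habsurd hr₂ hq₁ h₁.symm h₂.symm).elim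
  · exact Prod.ext (add_right_cancel (h₁.trans (congrArg (r.1 + ·) h₂.symm))) h₂

theorem isCut_cutForward (φ : (Fin 2 → ℝ) ≃ₗ[ℝ] ℝ × ℝ) (p : (Fin 2 → ℤ) × (Fin 2 → ℤ)) :
    IsCut p (cutForward φ p) := by
  rw [isCut_iff, cutForward]
  split_ifs
  exacts [.inr rfl, .inl rfl]

theorem isCut_cutBackward (φ : (Fin 2 → ℝ) ≃ₗ[ℝ] ℝ × ℝ) (p : (Fin 2 → ℤ) × (Fin 2 → ℤ)) :
    IsCut (cutBackward φ p) p := by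
  rw [isCut_iff, cutBackward]
  split_ifs <;> simp

theorem cutForward_mem_biFan (hφ : AxesIrrational φ) (hp : p ∈ biFan φ) :
    cutForward φ p ∈ biFan φ := by
  obtain ⟨hdet, ⟨hx₁, hy₁⟩, hx₂, hy₂⟩ := mem_biFan_iff.1 hp
  rw [mem_biFan_iff, (isCut_cutForward φ p).det_eq]
  have hy : 0 < yCoord φ (p.1 + p.2) := by rw [yCoord_add]; positivity
  rw [cutForward]
  split_ifs with h
  · exact ⟨hdet, ⟨h, hy⟩, hx₂, hy₂⟩
  · exact ⟨hdet, ⟨hx₁, hy₁⟩, (not_lt.1 h).lt_of_ne (hφ.xCoord_ne_zero hy.ne'), hy⟩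

theorem cutBackward_mem_biFan (hφ : AxesIrrational φ) (hp : p ∈ biFan φ) :
    cutBackward φ p ∈ biFan φ := by
  obtain ⟨hdet, ⟨hx₁, hy₁⟩, hx₂, hy₂⟩ := mem_biFan_iff.1 hp
  rw [mem_biFan_iff, ← (isCut_cutBackward φ p).det_eq]
  have hx : 0 < xCoord φ (p.1 - p.2) := by rw [xCoord_sub]; linarith
  rw [cutBackward]
  split_ifs with h
  · exact ⟨hdet, ⟨hx, h⟩, hx₂, hy₂⟩
  · have hy := (not_lt.1 h).lt_of_ne (hφ.yCoord_ne_zero hx.ne')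
    rw [xCoord_sub] at hx
    rw [yCoord_sub] at hy
    rw [xCoord_sub, yCoord_sub]
    exact ⟨hdet, ⟨hx₁, hy₁⟩, by linarith, by linarith⟩

/-- The cutting algorithm as a permutation of the bi-fan. -/
noncomputable def cutPerm (hφ : AxesIrrational φ) : Equiv.Perm (biFan φ) where
  toFun p := ⟨cutForward φ p, cutForward_mem_biFan hφ p.2⟩
  invFun p := ⟨cutBackward φ p, cutBackward_mem_biFan hφ p.2⟩
  left_inv p := Subtype.ext <| (isCut_cutBackward φ _).left_unique (isCut_cutForward φ _)
    (cutBackward_mem_biFan hφ (cutForward_mem_biFan hφ p.2)) p.2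
  right_inv p := Subtype.ext <| (isCut_cutForward φ _).right_unique (isCut_cutBackward φ _)
    (cutForward_mem_biFan hφ (cutBackward_mem_biFan hφ p.2)) p.2

theorem isCut_iff_cutPerm_eq (hφ : AxesIrrational φ) {p q : biFan φ} :
    IsCut p q ↔ cutPerm hφ p = q :=
  ⟨fun h => Subtype.ext ((isCut_cutForward φ p).right_unique h (cutPerm hφ p).2 q.2),
    fun h => h ▸ isCut_cutForward φ p⟩

theorem bases_eq_cutPerm_zpow (hφ : AxesIrrational φ) (h₀ : MemBiFan φ e₀ f₀) (n : ℤ) :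
    bases φ e₀ f₀ n = (cutPerm hφ ^ n) ⟨(e₀, f₀), h₀⟩ := by
  have hiterate (σ : Equiv.Perm (biFan φ)) (g : _ → _) (hσ : ∀ p, g p.1 = (σ p).1) (m : ℕ) :
      g^[m] (e₀, f₀) = (σ ^ m) ⟨(e₀, f₀), h₀⟩ := by
    rw [← Equiv.Perm.iterate_eq_pow]
    exact (Function.Semiconj.iterate_right (f := Subtype.val) (fun p => (hσ p).symm) m
      ⟨(e₀, f₀), h₀⟩).symm
  rcases n with m | m
  · rw [Int.ofNat_eq_natCast, zpow_natCast]
    exact hiterate _ (cutForward φ) (fun _ => rfl) m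
  · rw [zpow_negSucc, ← inv_pow]
    exact hiterate _ (cutBackward φ) (fun _ => rfl) (m + 1)

/-! ### Transitivity of the cutting algorithm -/

/-- The oriented area spanned by two lattice vectors, measured in the coordinates `φ`. It is used to
read off signs of coefficients from the position of the vectors. -/
noncomputable def area (φ : (Fin 2 → ℝ) ≃ₗ[ℝ] ℝ × ℝ) (v w : Fin 2 → ℤ) : ℝ :=
  xCoord φ v * yCoord φ w - xCoord φ w * yCoord φ v

theorem area_pos (hp : p ∈ biFan φ) (hq : q ∈ biFan φ) : 0 < area φ p.1 q.2 := by
  obtain ⟨-, ⟨hxp, hyp⟩, -⟩ := mem_biFan_iff.1 hp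
  obtain ⟨-, -, hxq, hyq⟩ := mem_biFan_iff.1 hq
  exact sub_pos.2 ((mul_neg_of_neg_of_pos hxq hyp).trans (mul_pos hxp hyq))

theorem exists_eq_smul_add_smul (hp : p ∈ biFan φ) (v : Fin 2 → ℤ) :
    ∃ a b : ℤ, v = a • p.1 + b • p.2 := by
  obtain ⟨a, b, h⟩ := Submodule.mem_span_pair.1 (hp.2.1.symm ▸ Submodule.mem_top : v ∈ _)
  exact ⟨a, b, h.symm⟩

theorem coeff_pos_of_mem_biFan {a b c d : ℤ} (hp : p ∈ biFan φ) (hq : q ∈ biFan φ)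
    (hq₁ : q.1 = a • p.1 + b • p.2) (hq₂ : q.2 = c • p.1 + d • p.2) :
    0 < a ∧ 0 < d ∧ a * d - b * c = 1 := by
  have hpp := area_pos hp hp
  have ha : area φ q.1 p.2 = a * area φ p.1 p.2 := by
    simp only [area, hq₁, xCoord_add, yCoord_add, xCoord_smul, yCoord_smul]; ring
  have hd : area φ p.1 q.2 = d * area φ p.1 p.2 := by
    simp only [area, hq₂, xCoord_add, yCoord_add, xCoord_smul, yCoord_smul]; ring
  have hadbc : area φ q.1 q.2 = (a * d - b * c : ℤ) * area φ p.1 p.2 := by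
    simp only [area, hq₁, hq₂, xCoord_add, yCoord_add, xCoord_smul, yCoord_smul]; push_cast; ring
  have hdet : (colMatrix q).det = (a * d - b * c) * (colMatrix p).det := by
    simp only [det_colMatrix, hq₁, hq₂, Pi.add_apply, Pi.smul_apply, smul_eq_mul]; ring
  have hunit : IsUnit (a * d - b * c) :=
    isUnit_of_mul_isUnit_left (hdet ▸ (mem_biFan_iff.1 hq).1)
  have hpos : 0 < a * d - b * c :=
    Int.cast_pos.1 (pos_of_mul_pos_left (hadbc ▸ area_pos hq hq) hpp.le)
  exact ⟨Int.cast_pos.1 (pos_of_mul_pos_left (ha ▸ area_pos hq hp) hpp.le),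
    Int.cast_pos.1 (pos_of_mul_pos_left (hd ▸ area_pos hp hq) hpp.le),
    (Int.isUnit_iff.1 hunit).resolve_right (by lia)⟩

theorem le_of_mul_sub_mul_eq_one {a b c d : ℤ} (hb : 0 ≤ b) (hc : 0 ≤ c) (hbc : 0 < b + c)
    (hcd : c < d) (hdet : a * d - b * c = 1) : a ≤ b := by
  by_contra! h
  nlinarith [mul_le_mul (Int.add_one_le_of_lt h) (Int.add_one_le_of_lt hcd) (by lia) (by lia)]

/-- If the cone of `q` is contained in that of `p`, then the next basis after `p` still has this
property, and the coefficients decrease. -/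
theorem sameCycle_cutPerm_of_nonneg (hφ : AxesIrrational φ) {p q : biFan φ} {a b c d : ℤ}
    (hb : 0 ≤ b) (hc : 0 ≤ c) (hq₁ : q.1.1 = a • p.1.1 + b • p.1.2)
    (hq₂ : q.1.2 = c • p.1.1 + d • p.1.2) :
    (cutPerm hφ).SameCycle p q := by
  obtain ⟨ha, hd, hdet⟩ := coeff_pos_of_mem_biFan p.2 q.2 hq₁ hq₂
  rcases eq_or_ne (b + c) 0 with hbc | hbc
  · obtain ⟨rfl, rfl⟩ : b = 0 ∧ c = 0 := by lia
    obtain ⟨rfl, rfl⟩ : a = 1 ∧ d = 1 := by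
      have had : a * d = 1 := by linarith
      exact ⟨Int.eq_one_of_mul_eq_one_right ha.le had, Int.eq_one_of_mul_eq_one_left hd.le had⟩
    have hpq : p = q := Subtype.ext (Prod.ext (by simp [hq₁]) (by simp [hq₂]))
    exact hpq ▸ .refl _ _
  rw [← Equiv.Perm.sameCycle_apply_left]
  obtain ⟨p', hp'⟩ : ∃ p', cutPerm hφ p = p' := ⟨_, rfl⟩
  rw [hp']
  rcases isCut_iff.1 ((isCut_iff_cutPerm_eq hφ).2 hp') with h | h <;>
    obtain ⟨h₁, h₂⟩ := Prod.ext_iff.1 h <;> dsimp only at h₁ h₂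
  · have hq₁' : q.1.1 = (a - b) • p'.1.1 + b • p'.1.2 := by rw [hq₁, h₁, h₂]; module
    have hq₂' : q.1.2 = (c - d) • p'.1.1 + d • p'.1.2 := by rw [hq₂, h₁, h₂]; module
    obtain ⟨hab, -, -⟩ := coeff_pos_of_mem_biFan p'.2 q.2 hq₁' hq₂'
    have hdc : d ≤ c := le_of_mul_sub_mul_eq_one hc hb (by lia) (sub_pos.1 hab) (by linarith)
    exact sameCycle_cutPerm_of_nonneg hφ hb (sub_nonneg.2 hdc) hq₁' hq₂'
  · have hq₁' : q.1.1 = a • p'.1.1 + (b - a) • p'.1.2 := by rw [hq₁, h₁, h₂]; module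
    have hq₂' : q.1.2 = c • p'.1.1 + (d - c) • p'.1.2 := by rw [hq₂, h₁, h₂]; module
    obtain ⟨-, hcd, -⟩ := coeff_pos_of_mem_biFan p'.2 q.2 hq₁' hq₂'
    have hab : a ≤ b := le_of_mul_sub_mul_eq_one hb hc (by lia) (sub_pos.1 hcd) hdet
    exact sameCycle_cutPerm_of_nonneg hφ (sub_nonneg.2 hab) hc hq₁' hq₂'
termination_by (b + c).toNat
decreasing_by all_goals lia

/-- Since `b * c = a * d - 1 ≥ 0`, the cone of one of the two bases contains that of the other. -/
theorem sameCycle_cutPerm (hφ : AxesIrrational φ) (p q : biFan φ) :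
    (cutPerm hφ).SameCycle p q := by
  obtain ⟨a, b, hq₁⟩ := exists_eq_smul_add_smul p.2 q.1.1
  obtain ⟨c, d, hq₂⟩ := exists_eq_smul_add_smul p.2 q.1.2
  obtain ⟨ha, hd, hdet⟩ := coeff_pos_of_mem_biFan p.2 q.2 hq₁ hq₂
  have hbc : 0 ≤ b * c := by linarith [Int.add_one_le_of_lt (mul_pos ha hd)]
  rcases mul_nonneg_iff.1 hbc with ⟨hb, hc⟩ | ⟨hb, hc⟩
  · exact sameCycle_cutPerm_of_nonneg hφ hb hc hq₁ hq₂
  · refine (sameCycle_cutPerm_of_nonneg hφ (neg_nonneg.2 hb) (neg_nonneg.2 hc) (a := d) (d := a)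
      ?_ ?_).symm
    · rw [hq₁, hq₂]
      linear_combination (norm := module) -hdet • p.1.1
    · rw [hq₁, hq₂]
      linear_combination (norm := module) -hdet • p.1.2

theorem exists_bases_eq (hφ : AxesIrrational φ) (h₀ : MemBiFan φ e₀ f₀) (hq : q ∈ biFan φ) :
    ∃ k, bases φ e₀ f₀ k = q := by
  obtain ⟨k, hk⟩ := sameCycle_cutPerm hφ ⟨(e₀, f₀), h₀⟩ ⟨q, hq⟩
  exact ⟨k, by rw [bases_eq_cutPerm_zpow hφ h₀, hk]⟩

/-! ### The sequence of bases and its symmetries -/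

theorem bases_mem_biFan (hφ : AxesIrrational φ) (h₀ : MemBiFan φ e₀ f₀) (n : ℤ) :
    bases φ e₀ f₀ n ∈ biFan φ :=
  bases_eq_cutPerm_zpow hφ h₀ n ▸ Subtype.coe_prop _

theorem bases_add_one (hφ : AxesIrrational φ) (h₀ : MemBiFan φ e₀ f₀) (n : ℤ) :
    bases φ e₀ f₀ (n + 1) = cutForward φ (bases φ e₀ f₀ n) := by
  simp only [bases_eq_cutPerm_zpow hφ h₀, add_comm n, _root_.zpow_one_add, Equiv.Perm.mul_apply]
  rfl

theorem isCut_bases (hφ : AxesIrrational φ) (h₀ : MemBiFan φ e₀ f₀) (n : ℤ) :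
    IsCut (bases φ e₀ f₀ n) (bases φ e₀ f₀ (n + 1)) :=
  bases_add_one hφ h₀ n ▸ isCut_cutForward φ _

theorem exists_map_bases_eq (hφ : AxesIrrational φ) (h₀ : MemBiFan φ e₀ f₀)
    {F : (Fin 2 → ℤ) × (Fin 2 → ℤ) → (Fin 2 → ℤ) × (Fin 2 → ℤ)}
    (hF : ∀ p ∈ biFan φ, F p ∈ biFan φ) (hcut : ∀ p q, IsCut p q → IsCut (F p) (F q)) :
    ∃ k, ∀ j, F (bases φ e₀ f₀ j) = bases φ e₀ f₀ (j + k) := by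
  have hmem := bases_mem_biFan hφ h₀
  have hFcut (j : ℤ) := hcut _ _ (isCut_bases hφ h₀ j)
  obtain ⟨k, hk⟩ := exists_bases_eq hφ h₀ (hF _ (hmem 0))
  refine ⟨k, fun j => ?_⟩
  induction j with
  | zero => rw [zero_add, hk]
  | succ j ih =>
    refine (hFcut j).right_unique ?_ (hF _ (hmem _)) (hmem _)
    rw [ih, add_right_comm]
    exact isCut_bases hφ h₀ _
  | pred j ih =>
    refine IsCut.left_unique (p := F (bases φ e₀ f₀ (-j))) ?_ ?_ (hF _ (hmem _)) (hmem _)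
    · simpa only [sub_add_cancel] using hFcut (-j - 1)
    · rw [ih]
      convert isCut_bases hφ h₀ (-j - 1 + k) using 2
      ring

/-- The vector `e_n + f_n`, which is the new vector of the basis with index `n + 1`. Unlike the
basis, it is not affected by an exchange of `e_n` and `f_n`. -/
noncomputable def mediant (φ : (Fin 2 → ℝ) ≃ₗ[ℝ] ℝ × ℝ) (e₀ f₀ : Fin 2 → ℤ) (n : ℤ) : Fin 2 → ℤ :=
  (bases φ e₀ f₀ n).1 + (bases φ e₀ f₀ n).2

theorem yCoord_mediant_pos (hφ : AxesIrrational φ) (h₀ : MemBiFan φ e₀ f₀) (n : ℤ) :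
    0 < yCoord φ (mediant φ e₀ f₀ n) := by
  obtain ⟨-, ⟨-, hy₁⟩, -, hy₂⟩ := mem_biFan_iff.1 (bases_mem_biFan hφ h₀ n)
  rw [mediant, yCoord_add]
  positivity

theorem strictMono_yCoord_mediant (hφ : AxesIrrational φ) (h₀ : MemBiFan φ e₀ f₀) :
    StrictMono fun n => yCoord φ (mediant φ e₀ f₀ n) := by
  refine strictMono_int_of_lt_succ fun n => ?_
  obtain ⟨-, ⟨-, hy₁⟩, -, hy₂⟩ := mem_biFan_iff.1 (bases_mem_biFan hφ h₀ n)
  rcases isCut_iff.1 (isCut_bases hφ h₀ n) with h | h <;>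
    simp only [mediant, h, yCoord_add] <;> linarith

theorem isUnit_det_mediant (hφ : AxesIrrational φ) (h₀ : MemBiFan φ e₀ f₀) (n : ℤ) :
    IsUnit (colMatrix (mediant φ e₀ f₀ n, mediant φ e₀ f₀ (n + 1))).det := by
  have hdet := (mem_biFan_iff.1 (bases_mem_biFan hφ h₀ n)).1
  rcases isCut_iff.1 (isCut_bases hφ h₀ n) with h | h
  · rw [← IsUnit.neg_iff]
    convert hdet using 1
    simp only [mediant, h, det_colMatrix, Pi.add_apply]
    ring
  · convert hdet using 1
    simp only [mediant, h, det_colMatrix, Pi.add_apply]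
    ring

/-- `A` acts on the sequence `e_n + f_n`, hence on the unordered bases `{e_n, f_n}`, as the
translation of the index by `k`. -/
def Shifts (φ : (Fin 2 → ℝ) ≃ₗ[ℝ] ℝ × ℝ) (e₀ f₀ : Fin 2 → ℤ) (A : GeneralLinearGroup (Fin 2) ℤ)
    (k : ℤ) : Prop :=
  ∀ j, A.1 *ᵥ mediant φ e₀ f₀ j = mediant φ e₀ f₀ (j + k)

namespace Shifts

variable {k l : ℤ}

theorem of_mapPair_eq (h : ∀ j, mapPair A (bases φ e₀ f₀ j) = bases φ e₀ f₀ (j + k)) :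
    Shifts φ e₀ f₀ A k := fun j => by
  rw [mediant, mulVec_fst_add_snd, h, mediant]

theorem of_mapPair_eq_swap
    (h : ∀ j, mapPair A (bases φ e₀ f₀ j) = (bases φ e₀ f₀ (j + k)).swap) :
    Shifts φ e₀ f₀ A k := fun j => by
  rw [mediant, mulVec_fst_add_snd, h, Prod.fst_swap, Prod.snd_swap, add_comm, mediant]

theorem unique (hφ : AxesIrrational φ) (h₀ : MemBiFan φ e₀ f₀) (hA : Shifts φ e₀ f₀ A k)
    (hB : Shifts φ e₀ f₀ B k) : A = B := by
  obtain ⟨G, hG⟩ :=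
    exists_mapPair_eq_iff (isUnit_det_mediant hφ h₀ 0) (isUnit_det_mediant hφ h₀ (0 + k))
  have heq {C : GeneralLinearGroup (Fin 2) ℤ} (hC : Shifts φ e₀ f₀ C k) : C = G :=
    (hG C).1 (Prod.ext (hC 0) ((hC (0 + 1)).trans (by rw [add_right_comm])))
  rw [heq hA, heq hB]

theorem one : Shifts φ e₀ f₀ 1 0 := fun j => by
  rw [Units.val_one, one_mulVec, add_zero]

theorem mul (hA : Shifts φ e₀ f₀ A k) (hB : Shifts φ e₀ f₀ B l) :
    Shifts φ e₀ f₀ (A * B) (k + l) := fun j => by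
  rw [Units.val_mul, ← mulVec_mulVec, hB, hA, add_assoc, add_comm l]

theorem inv (hA : Shifts φ e₀ f₀ A k) : Shifts φ e₀ f₀ A⁻¹ (-k) := fun j => by
  have h := hA (j + -k)
  rw [neg_add_cancel_right] at h
  rw [← h, mulVec_mulVec, ← Units.val_mul, inv_mul_cancel, Units.val_one, one_mulVec]

theorem zpow (hA : Shifts φ e₀ f₀ A k) (n : ℤ) : Shifts φ e₀ f₀ (A ^ n) (n * k) := by
  induction n with
  | zero => simpa using one
  | succ n ih => simpa only [_root_.zpow_add_one, add_one_mul] using ih.mul hA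
  | pred n ih =>
    rw [_root_.zpow_sub_one, sub_one_mul, sub_eq_add_neg]
    exact ih.mul hA.inv

end Shifts

namespace IsDiag

theorem mapPair_mem_biFan (hA : IsDiag φ A α β) (hα : 0 < α) (hβ : 0 < β) (hp : p ∈ biFan φ) :
    mapPair A p ∈ biFan φ := by
  obtain ⟨hdet, ⟨hx₁, hy₁⟩, hx₂, hy₂⟩ := mem_biFan_iff.1 hp
  rw [mem_biFan_iff, ← mul_colMatrix, det_mul]
  simp only [mapPair, hA.xCoord_mulVec, hA.yCoord_mulVec]
  exact ⟨((isUnit_iff_isUnit_det _).1 A.isUnit).mul hdet, ⟨mul_pos hα hx₁, mul_pos hβ hy₁⟩,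
    mul_neg_of_pos_of_neg hα hx₂, mul_pos hβ hy₂⟩

theorem swap_mapPair_mem_biFan (hA : IsDiag φ A α β) (hα : α < 0) (hβ : 0 < β)
    (hp : p ∈ biFan φ) : (mapPair A p).swap ∈ biFan φ := by
  obtain ⟨hdet, ⟨hx₁, hy₁⟩, hx₂, hy₂⟩ := mem_biFan_iff.1 hp
  rw [mem_biFan_iff, det_colMatrix_swap, ← mul_colMatrix, det_mul]
  simp only [mapPair, Prod.swap_prod_mk, hA.xCoord_mulVec, hA.yCoord_mulVec]
  exact ⟨(((isUnit_iff_isUnit_det _).1 A.isUnit).mul hdet).neg,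
    ⟨mul_pos_of_neg_of_neg hα hx₂, mul_pos hβ hy₂⟩, mul_neg_of_neg_of_pos hα hx₁, mul_pos hβ hy₁⟩

theorem exists_shifts (hφ : AxesIrrational φ) (h₀ : MemBiFan φ e₀ f₀) (hA : IsDiag φ A α β)
    (hβ : 0 < β) : ∃ k, Shifts φ e₀ f₀ A k := by
  rcases hA.ne_zero.1.lt_or_gt with hα | hα
  · obtain ⟨k, hk⟩ := exists_map_bases_eq hφ h₀ (fun _ => hA.swap_mapPair_mem_biFan hα hβ)
      fun _ _ h => (h.mapPair A).swap
    exact ⟨k, .of_mapPair_eq_swap fun j => by rw [← hk, Prod.swap_swap]⟩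
  · obtain ⟨k, hk⟩ := exists_map_bases_eq hφ h₀ (fun _ => hA.mapPair_mem_biFan hα hβ)
      fun _ _ h => h.mapPair A
    exact ⟨k, .of_mapPair_eq hk⟩

end IsDiag

theorem IsAdapted.exists_shifts_pos (hD : IsAdapted D φ) (h₀ : MemBiFan φ e₀ f₀) :
    ∃ D' k, (D' = D ∨ D' = -D) ∧ 0 < k ∧ Shifts φ e₀ f₀ D' k := by
  obtain ⟨D', μ, lam, hD', hlam, hdiag⟩ := hD.exists_expanding
  obtain ⟨k, hk⟩ := hdiag.exists_shifts hD.axesIrrational h₀ (one_pos.trans hlam)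
  refine ⟨D', k, hD', ?_, hk⟩
  rw [← (strictMono_yCoord_mediant hD.axesIrrational h₀).lt_iff_lt]
  have hy : yCoord φ (mediant φ e₀ f₀ k) = lam * yCoord φ (mediant φ e₀ f₀ 0) := by
    rw [← hdiag.yCoord_mulVec, hk, zero_add]
  exact (lt_mul_of_one_lt_left (yCoord_mediant_pos hD.axesIrrational h₀ 0) hlam).trans_eq hy.symm

/-- The indices add up under composition, so all shifting automorphisms commute, in particular with
`D` up to sign. -/
theorem Shifts.exists_isDiag {k : ℤ} (hD : IsAdapted D φ) (h₀ : MemBiFan φ e₀ f₀)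
    (hA : Shifts φ e₀ f₀ A k) : ∃ γ δ, 0 < δ ∧ IsDiag φ A γ δ := by
  have hφ := hD.axesIrrational
  obtain ⟨D', l, hD', -, hl⟩ := hD.exists_shifts_pos h₀
  have hcomm : Commute A D' := (hA.mul hl).unique hφ h₀ (add_comm l k ▸ hl.mul hA)
  have hmem : A ∈ Subgroup.centralizer {D} := by
    rw [Subgroup.mem_centralizer_singleton_iff]
    rcases hD' with rfl | rfl
    exacts [hcomm, Commute.neg_right_iff.1 hcomm]
  obtain ⟨γ, δ, hdiag⟩ := hD.mem_centralizer_iff.1 hmem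
  have hy := yCoord_mediant_pos hφ h₀ (0 + k)
  rw [← hA, hdiag.yCoord_mulVec] at hy
  exact ⟨γ, δ, pos_of_mul_pos_left hy (yCoord_mediant_pos hφ h₀ 0).le, hdiag⟩

/-! ### Symmetries of the cutting sequence -/

theorem cuttingSeq_eq_zero_or_one (n : ℤ) :
    cuttingSeq φ e₀ f₀ n = 0 ∨ cuttingSeq φ e₀ f₀ n = 1 := by
  unfold cuttingSeq
  split_ifs
  exacts [.inl rfl, .inr rfl]

theorem cuttingSeq_eq_ite (hφ : AxesIrrational φ) (h₀ : MemBiFan φ e₀ f₀) (n : ℤ) :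
    cuttingSeq φ e₀ f₀ n = if 0 < xCoord φ (mediant φ e₀ f₀ n) then 1 else 0 := by
  have hne : (bases φ e₀ f₀ n).2 ≠ 0 := fun h => by
    have hy := (mem_biFan_iff.1 (bases_mem_biFan hφ h₀ n)).2.2.2
    rw [h, yCoord_zero] at hy
    exact hy.false
  rw [cuttingSeq, bases_add_one hφ h₀, cutForward, mediant]
  split_ifs with h h' h'
  exacts [(hne (left_eq_add.1 h'.symm)).elim, rfl, rfl, (h' rfl).elim]

theorem bases_add_one_eq_cutWith (hφ : AxesIrrational φ) (h₀ : MemBiFan φ e₀ f₀) (n : ℤ) :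
    bases φ e₀ f₀ (n + 1) = cutWith (cuttingSeq φ e₀ f₀ n) (bases φ e₀ f₀ n) := by
  rw [cuttingSeq_eq_ite hφ h₀, bases_add_one hφ h₀, cutForward, mediant]
  split_ifs <;> rfl

theorem Shifts.xCoord_mediant_add {k : ℤ} (hdiag : IsDiag φ A α β) (hA : Shifts φ e₀ f₀ A k)
    (j : ℤ) :
    xCoord φ (mediant φ e₀ f₀ (j + k)) = α * xCoord φ (mediant φ e₀ f₀ j) := by
  rw [← hA, hdiag.xCoord_mulVec]

/-- An automorphism which preserves the right half-plane preserves the cutting sequence, and one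
which exchanges the right and the left half-plane exchanges `0` and `1`. -/
theorem Shifts.isPeriod_or_isSemiPeriod (hD : IsAdapted D φ) (h₀ : MemBiFan φ e₀ f₀) {n : ℕ}
    (hn : 0 < n) (hA : Shifts φ e₀ f₀ A n) :
    IsPeriod (cuttingSeq φ e₀ f₀) n ∨ IsSemiPeriod (cuttingSeq φ e₀ f₀) n := by
  have hφ := hD.axesIrrational
  obtain ⟨α, β, -, hdiag⟩ := hA.exists_isDiag hD h₀
  have hx (j : ℤ) : xCoord φ (mediant φ e₀ f₀ j) ≠ 0 :=
    hφ.xCoord_ne_zero (yCoord_mediant_pos hφ h₀ j).ne'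
  rcases hdiag.ne_zero.1.lt_or_gt with hα | hα
  · refine .inr ⟨hn, fun j => ?_⟩
    simp only [cuttingSeq_eq_ite hφ h₀, hA.xCoord_mediant_add hdiag]
    rcases (hx j).lt_or_gt with h | h
    · rw [if_pos (mul_pos_of_neg_of_neg hα h), if_neg h.not_gt, sub_zero]
    · rw [if_neg (mul_neg_of_neg_of_pos hα h).not_gt, if_pos h, sub_self]
  · refine .inl ⟨hn, fun j => ?_⟩
    simp only [cuttingSeq_eq_ite hφ h₀, hA.xCoord_mediant_add hdiag, mul_pos_iff_of_pos_left hα]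

theorem cutWith_injective (c : ℤ) : Function.Injective (cutWith c) := fun p q h => by
  unfold cutWith at h
  split_ifs at h <;> obtain ⟨h₁, h₂⟩ := Prod.mk.inj h
  · exact Prod.ext h₁ (add_left_cancel (a := p.1) (by rw [h₂, h₁]))
  · exact Prod.ext (add_right_cancel (b := p.2) (by rw [h₁, h₂])) h₂

theorem eq_of_forall_eq_cutWith {s : ℤ → ℤ} {u v : ℤ → (Fin 2 → ℤ) × (Fin 2 → ℤ)}
    (hu : ∀ j, u (j + 1) = cutWith (s j) (u j)) (hv : ∀ j, v (j + 1) = cutWith (s j) (v j))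
    (h0 : u 0 = v 0) (j : ℤ) : u j = v j := by
  induction j with
  | zero => exact h0
  | succ j ih => rw [hu, hv, ih]
  | pred j ih =>
    refine cutWith_injective (s (-j - 1)) ?_
    rw [← hu, ← hv, sub_add_cancel, ih]

theorem IsPeriod.shifts (hφ : AxesIrrational φ) (h₀ : MemBiFan φ e₀ f₀) {n : ℕ}
    (hn : IsPeriod (cuttingSeq φ e₀ f₀) n) (hA : mapPair A (e₀, f₀) = bases φ e₀ f₀ n) :
    Shifts φ e₀ f₀ A n := by
  have hbases := bases_add_one_eq_cutWith hφ h₀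
  refine .of_mapPair_eq (eq_of_forall_eq_cutWith (s := cuttingSeq φ e₀ f₀)
    (u := fun j => mapPair A (bases φ e₀ f₀ j)) (v := fun j => bases φ e₀ f₀ (j + n))
    (fun j => ?_) (fun j => ?_) ?_)
  · rw [hbases, mapPair_cutWith]
  · rw [add_right_comm, hbases, hn.2]
  · rw [zero_add]
    exact hA

theorem IsSemiPeriod.shifts (hφ : AxesIrrational φ) (h₀ : MemBiFan φ e₀ f₀) {n : ℕ}
    (hn : IsSemiPeriod (cuttingSeq φ e₀ f₀) n)
    (hA : mapPair A (e₀, f₀) = (bases φ e₀ f₀ n).swap) : Shifts φ e₀ f₀ A n := by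
  have hbases := bases_add_one_eq_cutWith hφ h₀
  refine .of_mapPair_eq_swap (eq_of_forall_eq_cutWith (s := cuttingSeq φ e₀ f₀)
    (u := fun j => mapPair A (bases φ e₀ f₀ j)) (v := fun j => (bases φ e₀ f₀ (j + n)).swap)
    (fun j => ?_) (fun j => ?_) ?_)
  · rw [hbases, mapPair_cutWith]
  · rw [add_right_comm, hbases, swap_cutWith (cuttingSeq_eq_zero_or_one _), hn.2, sub_sub_cancel]
  · rw [zero_add]
    exact hA

section

variable {s : ℤ → ℤ} {m n : ℕ}

theorem IsSemiPeriod.isPeriod_two_mul (hn : IsSemiPeriod s n) : IsPeriod s (2 * n) := by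
  refine ⟨mul_pos two_pos hn.1, fun j => ?_⟩
  rw [two_mul, Nat.cast_add, ← add_assoc, hn.2, hn.2, sub_sub_cancel]

theorem IsSemiPeriod.sub (hm : IsSemiPeriod s m) (hn : IsPeriod s n) (hnm : n < m) :
    IsSemiPeriod s (m - n) := by
  refine ⟨Nat.sub_pos_of_lt hnm, fun j => ?_⟩
  rw [← hm.2, ← hn.2, Nat.cast_sub hnm.le, add_assoc, sub_add_cancel]

theorem IsBasicSemiPeriod.le_of_isPeriod (hm : IsBasicSemiPeriod s m) (hn : IsPeriod s n) :
    m ≤ n := by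
  by_contra! hnm
  exact (hm.2 (hm.1.sub hn hnm)).not_gt (Nat.sub_lt hm.1.1 hn.1)

theorem exists_isBasicPeriod (hn : IsPeriod s n) : ∃ N, IsBasicPeriod s N :=
  ⟨sInf {n | IsPeriod s n}, Nat.sInf_mem ⟨n, hn⟩, fun _ => Nat.sInf_le⟩

end

theorem IsAdapted.exists_isBasicPeriod_cuttingSeq (hD : IsAdapted D φ) (h₀ : MemBiFan φ e₀ f₀) :
    ∃ N, IsBasicPeriod (cuttingSeq φ e₀ f₀) N := by
  obtain ⟨A, k, -, hk, hA⟩ := hD.exists_shifts_pos h₀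
  lift k to ℕ using hk.le
  rcases hA.isPeriod_or_isSemiPeriod hD h₀ (Int.natCast_pos.1 hk) with h | h
  exacts [exists_isBasicPeriod h, exists_isBasicPeriod h.isPeriod_two_mul]

/-! ### The generator -/

/-- `G` shifts the bases by `n ≥ 1` steps, and no automorphism shifts them by fewer steps. -/
def IsMinimalShift (φ : (Fin 2 → ℝ) ≃ₗ[ℝ] ℝ × ℝ) (e₀ f₀ : Fin 2 → ℤ)
    (G : GeneralLinearGroup (Fin 2) ℤ) (n : ℕ) : Prop :=
  Shifts φ e₀ f₀ G n ∧ IsLeast {m : ℕ | 0 < m ∧ ∃ A, Shifts φ e₀ f₀ A m} n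

namespace IsMinimalShift

variable {n : ℕ}

theorem exists_eq_zpow (hφ : AxesIrrational φ) (h₀ : MemBiFan φ e₀ f₀)
    (hG : IsMinimalShift φ e₀ f₀ G n) {k : ℤ} (hA : Shifts φ e₀ f₀ A k) :
    ∃ i : ℤ, k = i * n ∧ A = G ^ i := by
  obtain ⟨hG, ⟨hn, -⟩, hmin⟩ := hG
  have hn' : (0 : ℤ) < n := Int.natCast_pos.2 hn
  have hmod : Shifts φ e₀ f₀ (A * (G ^ (k / n))⁻¹) (k % n) := by
    convert hA.mul (hG.zpow (k / n)).inv using 1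
    rw [Int.emod_def, mul_comm, sub_eq_add_neg]
  have hk : k / n * n = k := by
    refine Int.ediv_mul_cancel (Int.dvd_of_emod_eq_zero ?_)
    by_contra hne
    have hlt := Int.emod_lt_of_pos k hn'
    obtain ⟨m, hm⟩ := Int.eq_ofNat_of_zero_le (Int.emod_nonneg k hn'.ne')
    rw [hm] at hne hlt hmod
    have := hmin ⟨by lia, _, hmod⟩
    lia
  have hzpow : Shifts φ e₀ f₀ (G ^ (k / n)) k := by simpa only [hk] using hG.zpow (k / n)
  exact ⟨k / n, hk.symm, hA.unique hφ h₀ hzpow⟩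

theorem exists_pow_eq (hD : IsAdapted D φ) (h₀ : MemBiFan φ e₀ f₀)
    (hG : IsMinimalShift φ e₀ f₀ G n) : ∃ K : ℕ, 0 < K ∧ (G ^ K = D ∨ G ^ K = -D) := by
  obtain ⟨D', k, hD', hk, hshift⟩ := hD.exists_shifts_pos h₀
  obtain ⟨i, rfl, rfl⟩ := hG.exists_eq_zpow hD.axesIrrational h₀ hshift
  have hi : 0 < i := pos_of_mul_pos_left hk (Int.natCast_nonneg n)
  lift i to ℕ using hi.le
  exact ⟨i, Int.natCast_pos.1 hi, by simpa only [zpow_natCast] using hD'⟩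

theorem centralizer_eq (hD : IsAdapted D φ) (h₀ : MemBiFan φ e₀ f₀)
    (hG : IsMinimalShift φ e₀ f₀ G n) :
    (Subgroup.centralizer {D} : Set (GeneralLinearGroup (Fin 2) ℤ)) =
      {A | ∃ k : ℤ, A = G ^ k ∨ A = -G ^ k} := by
  have hφ := hD.axesIrrational
  have hpos {A : GeneralLinearGroup (Fin 2) ℤ} {γ δ : ℝ} (hA : IsDiag φ A γ δ) (hδ : 0 < δ) :
      ∃ k : ℤ, A = G ^ k := by
    obtain ⟨k, hk⟩ := hA.exists_shifts hφ h₀ hδ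
    obtain ⟨i, -, hi⟩ := hG.exists_eq_zpow hφ h₀ hk
    exact ⟨i, hi⟩
  ext A
  rw [SetLike.mem_coe, hD.mem_centralizer_iff]
  constructor
  · rintro ⟨γ, δ, hA⟩
    rcases hA.ne_zero.2.lt_or_gt with hδ | hδ
    · obtain ⟨k, hk⟩ := hpos hA.neg (neg_pos.2 hδ)
      exact ⟨k, .inr (neg_eq_iff_eq_neg.1 hk)⟩
    · obtain ⟨k, hk⟩ := hpos hA hδ
      exact ⟨k, .inl hk⟩
  · rintro ⟨k, hk⟩
    obtain ⟨γ, δ, -, hdiag⟩ := (hG.1.zpow k).exists_isDiag hD h₀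
    rcases hk with rfl | rfl
    exacts [⟨γ, δ, hdiag⟩, ⟨-γ, -δ, hdiag.neg⟩]

theorem isGeneratorOf (hD : IsAdapted D φ) (h₀ : MemBiFan φ e₀ f₀)
    (hG : IsMinimalShift φ e₀ f₀ G n) : IsGeneratorOf φ D G := by
  obtain ⟨_, _, -, hdiag⟩ := hG.1.exists_isDiag hD h₀
  exact ⟨hdiag.preservesAxes, hG.exists_pow_eq hD h₀, hG.centralizer_eq hD h₀⟩

end IsMinimalShift

theorem IsBasicSemiPeriod.isMinimalShift (hD : IsAdapted D φ) (h₀ : MemBiFan φ e₀ f₀) {n : ℕ}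
    (hn : IsBasicSemiPeriod (cuttingSeq φ e₀ f₀) n)
    (hG : mapPair G (e₀, f₀) = (bases φ e₀ f₀ n).swap) : IsMinimalShift φ e₀ f₀ G n := by
  have hshift := hn.1.shifts hD.axesIrrational h₀ hG
  refine ⟨hshift, ⟨hn.1.1, G, hshift⟩, fun m ⟨hm, _, hA⟩ => ?_⟩
  exact (hA.isPeriod_or_isSemiPeriod hD h₀ hm).elim hn.le_of_isPeriod (hn.2 ·)

theorem IsBasicPeriod.isMinimalShift (hD : IsAdapted D φ) (h₀ : MemBiFan φ e₀ f₀) {n : ℕ}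
    (hn : IsBasicPeriod (cuttingSeq φ e₀ f₀) n)
    (hsemi : ¬ ∃ m, IsSemiPeriod (cuttingSeq φ e₀ f₀) m)
    (hG : mapPair G (e₀, f₀) = bases φ e₀ f₀ n) : IsMinimalShift φ e₀ f₀ G n := by
  have hshift := hn.1.shifts hD.axesIrrational h₀ hG
  refine ⟨hshift, ⟨hn.1.1, G, hshift⟩, fun m ⟨hm, _, hA⟩ => ?_⟩
  exact (hA.isPeriod_or_isSemiPeriod hD h₀ hm).elim (hn.2 ·) fun h => (hsemi ⟨m, h⟩).elim

end ToralBiFan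

theorem mainTheorem3 (D : Matrix.GeneralLinearGroup (Fin 2) ℤ) (hD : ToralBiFan.IsHyperbolic D)
    (φ : (Fin 2 → ℝ) ≃ₗ[ℝ] ℝ × ℝ) (hφ : ToralBiFan.IsAdapted D φ)
    (e₀ f₀ : Fin 2 → ℤ) (h₀ : ToralBiFan.MemBiFan φ e₀ f₀) :
    -- the cutting sequence is periodic, so that the basic period makes sense
    (∃ N : ℕ, ToralBiFan.IsBasicPeriod (ToralBiFan.cuttingSeq φ e₀ f₀) N) ∧
    -- the case of the semi-period: `e₀ ↦ f_N`, `f₀ ↦ e_N` defines a unique automorphism `G`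
    (∀ N : ℕ, ToralBiFan.IsBasicSemiPeriod (ToralBiFan.cuttingSeq φ e₀ f₀) N →
      ∃ G : Matrix.GeneralLinearGroup (Fin 2) ℤ,
        (∀ A : Matrix.GeneralLinearGroup (Fin 2) ℤ,
          (A.1.mulVec e₀ = (ToralBiFan.bases φ e₀ f₀ N).2 ∧
            A.1.mulVec f₀ = (ToralBiFan.bases φ e₀ f₀ N).1) ↔ A = G) ∧
        ToralBiFan.IsGeneratorOf φ D G) ∧
    -- the case of the period, when there is no semi-period: `e₀ ↦ e_N`, `f₀ ↦ f_N`
    ((¬ ∃ M : ℕ, ToralBiFan.IsSemiPeriod (ToralBiFan.cuttingSeq φ e₀ f₀) M) →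
      ∀ N : ℕ, ToralBiFan.IsBasicPeriod (ToralBiFan.cuttingSeq φ e₀ f₀) N →
      ∃ G : Matrix.GeneralLinearGroup (Fin 2) ℤ,
        (∀ A : Matrix.GeneralLinearGroup (Fin 2) ℤ,
          (A.1.mulVec e₀ = (ToralBiFan.bases φ e₀ f₀ N).1 ∧
            A.1.mulVec f₀ = (ToralBiFan.bases φ e₀ f₀ N).2) ↔ A = G) ∧
        ToralBiFan.IsGeneratorOf φ D G) := by
  have hdet₀ := (ToralBiFan.mem_biFan_iff (p := (e₀, f₀)).1 h₀).1
  have hdet (n : ℤ) := (ToralBiFan.mem_biFan_iff.1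
    (ToralBiFan.bases_mem_biFan hφ.axesIrrational h₀ n)).1
  have hdet_swap (n : ℤ) := (hdet n).neg
  simp only [← ToralBiFan.det_colMatrix_swap] at hdet_swap
  refine ⟨hφ.exists_isBasicPeriod_cuttingSeq h₀, fun N hN => ?_, fun hsemi N hN => ?_⟩
  · obtain ⟨G, hG⟩ := ToralBiFan.exists_mapPair_eq_iff hdet₀ (hdet_swap N)
    have hmin := hN.isMinimalShift hφ h₀ ((hG G).2 rfl)
    exact ⟨G, fun A => Prod.ext_iff.symm.trans (hG A), hmin.isGeneratorOf hφ h₀⟩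
  · obtain ⟨G, hG⟩ := ToralBiFan.exists_mapPair_eq_iff hdet₀ (hdet N)
    have hmin := hN.isMinimalShift hφ h₀ hsemi ((hG G).2 rfl)
    exact ⟨G, fun A => Prod.ext_iff.symm.trans (hG A), hmin.isGeneratorOf hφ h₀⟩
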